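/- Let $n\ge 1$, let $a<b$ be real, and let $\Lambda_n=(\lambda_0,\dots,\lambda_n)\in\mathbb{R}^{n+1}$ with $\lambda_0=0$ and $\lambda_1\ne\lambda_0$. For a real vector $\Lambda=(\mu_0,\dots,\mu_r)$ with $r\ge 0$, let $E_\Lambda$ be the space of all $g\in C^\infty(\mathbb{R},\mathbb{C})$ with $(\frac{d}{dx}-\mu_0)\cdots(\frac{d}{dx}-\mu_r)g=0$, and for $0\le k\le r$ let $p_{\Lambda,k}$ be the function in $E_\Lambda$ that has a zero of exact order $k$ at $a$, a zero of exact order $r-k$ at $b$, and satisfies $p_{\Lambda,k}^{(k)}(a)=1$. Let $B=B_{(\lambda_0,\dots,\lambda_n)}$ be the exponential Bernstein operator on $[a,b]$, that is, $$Bf(x)=\sum_{k=0}^n\alpha_k f(t_k)\,p_{\Lambda_n,k}(x),\qquad f\in C([a,b],\mathbb{C}),\ x\in\mathbb{R},$$ with knots $t_0<t_1<\dots<t_n$ in $[a,b]$ and weights $\alpha_0,\dots,\alpha_n>0$ such that $B(e^{\lambda_0\cdot})(x)=e^{\lambda_0x}$ and $B(e^{\lambda_1\cdot})(x)=e^{\lambda_1x}$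 for $x\in[a,b]$. For $j\in\{0,\dots,n\}$ let $\Lambda_n\setminus\lambda_j$ be the vector obtained from $\Lambda_n$ by deleting the entry with index $j$. Then, for every $j\in\{0,\dots,n\}$, the functions $p_{\Lambda_n,k}$ $(0\le k\le n)$ and $p_{\Lambda_n\setminus\lambda_j,k}$ $(0\le k\le n-1)$ exist and are unique, the limits $$d^{k,\lambda_j}:=\lim_{x\to b}\frac{p_{\Lambda_n,k}'(x)}{p_{\Lambda_n\setminus\lambda_j,k}(x)},\qquad 0\le k\le n-1,$$ exist (in particular so do the $d^{k,\lambda_0}$), and with $$(\Delta_{\Lambda_n,\lambda_j}y)_k:=d^{k,\lambda_j}y_k-d^{k,\lambda_0}y_{k+1},\qquad 0\le k\le n-1,\ y=(y_0,\dots,y_n)\in\mathbb{C}^{n+1},$$ the following identity holds for all $f\in C([a,b],\mathbb{C})$ and $x\in\mathbb{R}$: $$\Big(\frac{d}{dx}-\lambda_j\Big)Bf(x)=\sum_{k=0}^{n-1}\big(\Delta_{\Lambda_n,\lambda_j}[f(t_i)]_{i=0}^{n}\big)_k\,\alpha_k\,p_{\Lambda_n\setminus\lambda_j,k}(x).$$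 -/

import Mathlib

open Filter Topology

noncomputable section

namespace ExpBernstein

/-- The differential operator `(d/dx - Λ₀) ⋯ (d/dx - Λ_{m-1})` applied to `f`. -/
def diffOp : {m : ℕ} → (Fin m → ℂ) → (ℝ → ℂ) → ℝ → ℂ
  | 0, _, f => f
  | _ + 1, Λ, f => fun x =>
      deriv (diffOp (Fin.tail Λ) f) x - Λ 0 * diffOp (Fin.tail Λ) f x

/-- The space of exponential polynomials: smooth complex-valued functions on `ℝ` annihilated by
the operator with eigenvalue vector `Λ`. -/
def expPoly {m : ℕ} (Λ : Fin m → ℂ) : Set (ℝ → ℂ) :=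
  {f | ContDiff ℝ ((⊤ : ℕ∞) : WithTop ℕ∞) f ∧ ∀ x, diffOp Λ f x = 0}

/-- `f` has a zero of exact order `k` at `c` (order `0` means `f c ≠ 0`). -/
def HasZeroOfOrder (f : ℝ → ℂ) (k : ℕ) (c : ℝ) : Prop :=
  (∀ i < k, iteratedDeriv i f c = 0) ∧ iteratedDeriv k f c ≠ 0

/-- `g` is the `k`-th normalized Bernstein basis function (`k < m`) of the space with the `m`
eigenvalues `Λ`: an element of that space with a zero of exact order `k` at `a`, a zero of exact
order `m - 1 - k` at `b`, and `k`-th derivative `1` at `a`. -/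
structure IsBernsteinFunction {m : ℕ} (Λ : Fin m → ℂ) (a b : ℝ) (k : ℕ) (g : ℝ → ℂ) : Prop where
  mem : g ∈ expPoly Λ
  zero_left : HasZeroOfOrder g k a
  zero_right : HasZeroOfOrder g (m - 1 - k) b
  normalized : iteratedDeriv k g a = 1

open Classical in
/-- The normalized Bernstein basis function `p_{Λ,k}` with respect to `a, b`
(the zero function if there is none). -/
def bernsteinFun {m : ℕ} (Λ : Fin m → ℂ) (a b : ℝ) (k : ℕ) : ℝ → ℂ :=
  if h : ∃ g, IsBernsteinFunction Λ a b k g then h.choose else 0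

/-- The vector `Λ` with its entry of index `j` deleted. -/
def delete {n : ℕ} (Λ : Fin (n + 1) → ℂ) (j : Fin (n + 1)) : Fin n → ℂ :=
  fun i => Λ (j.succAbove i)

/-- The quotient `p_{Λ,k}' / p_{Λ∖λ_j,k}`. -/
def derivQuotient {n : ℕ} (Λ : Fin (n + 1) → ℂ) (a b : ℝ) (j : Fin (n + 1)) (k : ℕ) : ℝ → ℂ :=
  fun x => deriv (bernsteinFun Λ a b k) x / bernsteinFun (delete Λ j) a b k x

/-- The number `d_Λ^{k,λ_j}`, the limit of `p_{Λ,k}' / p_{Λ∖λ_j,k}` at `b`. -/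
def dCoeff {n : ℕ} (Λ : Fin (n + 1) → ℂ) (a b : ℝ) (j : Fin (n + 1)) (k : ℕ) : ℂ :=
  limUnder (𝓝[≠] b) (derivQuotient Λ a b j k)

/-- The difference operator `Δ_{Λ,λ_j}`, on the components where the numbers `d` are defined. -/
def diffΔ {n : ℕ} (Λ : Fin (n + 1) → ℂ) (a b : ℝ) (j : Fin (n + 1)) (y : Fin (n + 1) → ℂ) :
    Fin n → ℂ :=
  fun k => dCoeff Λ a b j k * y k.castSucc - dCoeff Λ a b 0 k * y k.succ

/-- The operator `f ↦ ∑ₖ αₖ f(tₖ) p_{Λ,k}` with knots `t` and weights `α`. -/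
def bernsteinOp {n : ℕ} (Λ : Fin (n + 1) → ℂ) (a b : ℝ) (t : Fin (n + 1) → Set.Icc a b)
    (α : Fin (n + 1) → ℝ) (f : Set.Icc a b → ℂ) : ℝ → ℂ :=
  fun x => ∑ k : Fin (n + 1), (α k : ℂ) * f (t k) * bernsteinFun Λ a b k x

/-- `t` and `α` are the knots and weights of the exponential Bernstein operator `B_Λ` on `[a,b]`:
the knots increase strictly, the weights are positive, and the operator reproduces
`e^{λ₀ x}` and `e^{λ₁ x}` on `[a,b]`. -/
structure IsBernsteinData {n : ℕ} (Λ : Fin (n + 1) → ℂ) (a b : ℝ) (t : Fin (n + 1) → Set.Icc a b)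
    (α : Fin (n + 1) → ℝ) : Prop where
  knots : StrictMono t
  weights : ∀ k, 0 < α k
  reproduces_zero : ∀ x ∈ Set.Icc a b,
    bernsteinOp Λ a b t α (fun s => Complex.exp (Λ 0 * ((s : ℝ) : ℂ))) x = Complex.exp (Λ 0 * x)
  reproduces_one : ∀ x ∈ Set.Icc a b,
    bernsteinOp Λ a b t α (fun s => Complex.exp (Λ 1 * ((s : ℝ) : ℂ))) x = Complex.exp (Λ 1 * x)

end ExpBernstein

end

open ExpBernstein

open ExpBernstein

/-! Write `p_k` for the basis of the full space and `q_k` for that of the space with `λ_j` deleted.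
The core is the two-term formula `p_k' - λ_j p_k = q_{k-1} + d_k q_k` (`shiftDeriv_bernsteinFun`),
with `q_{-1} = 0` and no `d`-term for `k = n`. The left side minus `q_{k-1}` lies in the smaller
space, vanishes to order `k` at `a` by normalization and to order `n - 1 - k` at `b`, so it is a
multiple of `q_k`. Near `b`, `q_{k-1}` and `p_k` vanish to one order more than `q_k`, so `p_k' /
q_k` tends to that multiple.

For `λ_0 = 0`, differentiating `∑ α_k p_k = 1` and using independence of the basis gives `α_{k+1} =
-d^{k,λ_0} α_k` (`weight_succ`). Inserting this in the derivative of `∑ α_k f(t_k) p_k` yields the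
claim.

Existence and uniqueness of the bases rest on a Rolle-type zero count (`eq_zero_of_vanishesTo`): for
real eigenvalues, `m` endpoint zeros force an element of an `m`-eigenvalue space to vanish. -/

namespace ExpBernstein

/-! ### Algebra of the first order factors -/

/-- Infinitely differentiable functions on the real line. -/
abbrev Smooth (f : ℝ → ℂ) : Prop := ContDiff ℝ ((⊤ : ℕ∞) : WithTop ℕ∞) f

/-- The first order operator `d/dx - c`. -/
noncomputable def shiftDeriv (c : ℂ) (f : ℝ → ℂ) : ℝ → ℂ := fun x => deriv f x - c * f x

/-- `f` has a zero of order at least `k` at `c`. -/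
def VanishesTo (f : ℝ → ℂ) (k : ℕ) (c : ℝ) : Prop := ∀ i < k, iteratedDeriv i f c = 0

lemma Smooth.differentiable {f : ℝ → ℂ} (hf : Smooth f) : Differentiable ℝ f :=
  ContDiff.differentiable hf (by simp)

lemma Smooth.deriv {f : ℝ → ℂ} (hf : Smooth f) : Smooth (deriv f) :=
  (contDiff_infty_iff_deriv.1 hf).2

lemma Smooth.contDiff_nat {f : ℝ → ℂ} (hf : Smooth f) (i : ℕ) : ContDiff ℝ i f :=
  contDiff_infty.1 hf i

lemma Smooth.add_smul {f g : ℝ → ℂ} (hf : Smooth f) (hg : Smooth g) (c : ℂ) :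
    Smooth (f + c • g) :=
  ContDiff.add hf (contDiff_const.smul hg)

lemma Smooth.shiftDeriv {f : ℝ → ℂ} (hf : Smooth f) (c : ℂ) : Smooth (shiftDeriv c f) :=
  hf.deriv.sub (contDiff_const.mul hf)

lemma Smooth.diffOp {f : ℝ → ℂ} (hf : Smooth f) {m : ℕ} (Λ : Fin m → ℂ) : Smooth (diffOp Λ f) := by
  induction m with
  | zero => exact hf
  | succ m ih => exact (ih (Fin.tail Λ)).shiftDeriv (Λ 0)

lemma diffOp_succ {m : ℕ} (Λ : Fin (m + 1) → ℂ) (f : ℝ → ℂ) :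
    diffOp Λ f = shiftDeriv (Λ 0) (diffOp (Fin.tail Λ) f) := rfl

lemma shiftDeriv_add_smul {f g : ℝ → ℂ} (hf : Smooth f) (hg : Smooth g) (c d : ℂ) :
    shiftDeriv d (f + c • g) = shiftDeriv d f + c • shiftDeriv d g := by
  funext x
  have h : deriv (f + c • g) x = deriv f x + c * deriv g x := by
    rw [deriv_add (hf.differentiable x) ((hg.differentiable x).const_smul c),
      deriv_const_smul _ (hg.differentiable x), smul_eq_mul]
  simp only [shiftDeriv, h, Pi.add_apply, Pi.smul_apply, smul_eq_mul]
  ring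

lemma diffOp_add_smul {f g : ℝ → ℂ} (hf : Smooth f) (hg : Smooth g) (c : ℂ) {m : ℕ}
    (Λ : Fin m → ℂ) : diffOp Λ (f + c • g) = diffOp Λ f + c • diffOp Λ g := by
  induction m with
  | zero => rfl
  | succ m ih =>
    rw [diffOp_succ, ih, shiftDeriv_add_smul (hf.diffOp _) (hg.diffOp _), ← diffOp_succ,
      ← diffOp_succ]

lemma shiftDeriv_eq (c : ℂ) (f : ℝ → ℂ) : shiftDeriv c f = deriv f + (-c) • f := by
  funext x
  simp [shiftDeriv, sub_eq_add_neg]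

lemma shiftDeriv_comm {f : ℝ → ℂ} (hf : Smooth f) (c d : ℂ) :
    shiftDeriv c (shiftDeriv d f) = shiftDeriv d (shiftDeriv c f) := by
  rw [shiftDeriv_eq d f, shiftDeriv_add_smul hf.deriv hf, shiftDeriv_eq c f,
    shiftDeriv_add_smul hf.deriv hf]
  simp only [shiftDeriv_eq]
  module

lemma diffOp_shiftDeriv {f : ℝ → ℂ} (hf : Smooth f) {m : ℕ} (Λ : Fin m → ℂ) (c : ℂ) :
    diffOp Λ (shiftDeriv c f) = shiftDeriv c (diffOp Λ f) := by
  induction m with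
  | zero => rfl
  | succ m ih => rw [diffOp_succ, ih, shiftDeriv_comm (hf.diffOp _), diffOp_succ]

lemma delete_zero {n : ℕ} (Λ : Fin (n + 1) → ℂ) : delete Λ 0 = Fin.tail Λ := by
  funext i
  simp [delete, Fin.tail]

/-- First order factors commute on smooth functions, so the factor of index `j` can be moved
innermost. -/
lemma diffOp_delete {f : ℝ → ℂ} (hf : Smooth f) {n : ℕ} (Λ : Fin (n + 1) → ℂ) (j : Fin (n + 1)) :
    diffOp (delete Λ j) (shiftDeriv (Λ j) f) = diffOp Λ f := by
  induction n with
  | zero =>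
    obtain rfl : j = 0 := Fin.ext (by omega)
    rfl
  | succ n ih =>
    refine Fin.cases ?_ (fun i => ?_) j
    · rw [delete_zero, diffOp_shiftDeriv hf, ← diffOp_succ]
    · have h1 : Fin.tail (delete Λ i.succ) = delete (Fin.tail Λ) i := by
        funext l
        simp [delete, Fin.tail]
      have h2 : delete Λ i.succ 0 = Λ 0 := by simp [delete]
      have h3 : Λ i.succ = Fin.tail Λ i := rfl
      rw [diffOp_succ, h1, h2, h3, ih, ← diffOp_succ]

/-- The space of exponential polynomials as a submodule. -/
def expPolySubmodule {m : ℕ} (Λ : Fin m → ℂ) : Submodule ℂ (ℝ → ℂ) where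
  carrier := expPoly Λ
  zero_mem' := by
    refine ⟨contDiff_const, fun x => ?_⟩
    -- Since `0 = 0 + (-1) • 0`, linearity gives `D 0 = D 0 - D 0`.
    have h := diffOp_add_smul (f := 0) (g := 0) contDiff_const contDiff_const (-1) Λ
    have h' : (0 : ℝ → ℂ) + (-1 : ℂ) • 0 = 0 := by simp
    rw [h'] at h
    rw [h]
    simp
  add_mem' := by
    rintro f g ⟨hf, hf'⟩ ⟨hg, hg'⟩
    refine ⟨hf.add hg, fun x => ?_⟩
    have := congrFun (diffOp_add_smul hf hg 1 Λ) x
    rw [one_smul] at this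
    rw [this]
    simp [hf', hg']
  smul_mem' := by
    rintro c f ⟨hf, hf'⟩
    refine ⟨contDiff_const.smul hf, fun x => ?_⟩
    have := congrFun (diffOp_add_smul hf hf (c - 1) Λ) x
    have h' : f + (c - 1) • f = c • f := by module
    rw [h'] at this
    rw [this]
    simp [hf']

lemma shiftDeriv_mem_expPoly {n : ℕ} {Λ : Fin (n + 1) → ℂ} {f : ℝ → ℂ} (hf : f ∈ expPoly Λ)
    (j : Fin (n + 1)) : shiftDeriv (Λ j) f ∈ expPoly (delete Λ j) :=
  ⟨Smooth.shiftDeriv hf.1 _, fun x => by rw [diffOp_delete hf.1]; exact hf.2 x⟩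

lemma mem_expPoly_of_shiftDeriv {n : ℕ} {Λ : Fin (n + 1) → ℂ} {f : ℝ → ℂ} (hf : Smooth f)
    (j : Fin (n + 1)) (h : shiftDeriv (Λ j) f ∈ expPoly (delete Λ j)) : f ∈ expPoly Λ :=
  ⟨hf, fun x => by rw [← diffOp_delete hf Λ j]; exact h.2 x⟩

/-! ### Orders of vanishing -/

lemma iteratedDeriv_add_smul {f g : ℝ → ℂ} (hf : Smooth f) (hg : Smooth g) (c : ℂ) (i : ℕ)
    (x : ℝ) :
    iteratedDeriv i (f + c • g) x = iteratedDeriv i f x + c * iteratedDeriv i g x := by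
  rw [iteratedDeriv_add (hf.contDiff_nat i).contDiffAt
    (show ContDiff ℝ i (c • g) from (hg.contDiff_nat i).const_smul c).contDiffAt,
    iteratedDeriv_const_smul_field, smul_eq_mul]

lemma iteratedDeriv_shiftDeriv {f : ℝ → ℂ} (hf : Smooth f) (c : ℂ) (i : ℕ) (x : ℝ) :
    iteratedDeriv i (shiftDeriv c f) x = iteratedDeriv (i + 1) f x - c * iteratedDeriv i f x := by
  rw [shiftDeriv_eq, iteratedDeriv_add_smul hf.deriv hf, ← iteratedDeriv_succ']
  ring

lemma VanishesTo.mono {f : ℝ → ℂ} {k l : ℕ} {c : ℝ} (h : VanishesTo f k c) (hl : l ≤ k) :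
    VanishesTo f l c :=
  fun i hi => h i (hi.trans_le hl)

lemma VanishesTo.shiftDeriv {f : ℝ → ℂ} (hf : Smooth f) {k : ℕ} {x : ℝ} (h : VanishesTo f k x)
    (c : ℂ) : VanishesTo (shiftDeriv c f) (k - 1) x := by
  intro i hi
  rw [iteratedDeriv_shiftDeriv hf, h _ (by omega), h _ (by omega)]
  simp

lemma VanishesTo.add_smul {f g : ℝ → ℂ} (hf : Smooth f) (hg : Smooth g) {k : ℕ} {x : ℝ}
    (h : VanishesTo f k x) (h' : VanishesTo g k x) (c : ℂ) : VanishesTo (f + c • g) k x := by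
  intro i hi
  rw [iteratedDeriv_add_smul hf hg, h i hi, h' i hi]
  simp

lemma VanishesTo.succ {f : ℝ → ℂ} {k : ℕ} {x : ℝ} (h : VanishesTo f k x)
    (h' : iteratedDeriv k f x = 0) : VanishesTo f (k + 1) x := by
  intro i hi
  rcases Nat.lt_succ_iff_lt_or_eq.1 hi with hi | rfl
  exacts [h i hi, h']

lemma iteratedDeriv_sum_smul {ι : Type*} (s : Finset ι) (c : ι → ℂ) {f : ι → ℝ → ℂ}
    (hf : ∀ i ∈ s, Smooth (f i)) (k : ℕ) (x : ℝ) :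
    iteratedDeriv k (∑ i ∈ s, c i • f i) x = ∑ i ∈ s, c i * iteratedDeriv k (f i) x := by
  rw [iteratedDeriv_sum fun i hi => show ContDiffAt ℝ k (c i • f i) x from
    ((hf i hi).contDiff_nat k).contDiffAt.const_smul (c i)]
  refine Finset.sum_congr rfl fun i hi => ?_
  rw [iteratedDeriv_const_smul_field, smul_eq_mul]

/-- The matrix of derivatives at `a` is triangular with nonzero diagonal. -/
lemma eq_zero_of_iteratedDeriv_sum_eq_zero {n : ℕ} {f : Fin n → ℝ → ℂ} {a : ℝ}
    (hf : ∀ i, HasZeroOfOrder (f i) i a) (c : Fin n → ℂ)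
    (h : ∀ k < n, ∑ i, c i * iteratedDeriv k (f i) a = 0) : c = 0 := by
  have key : ∀ k (hk : k < n), c ⟨k, hk⟩ = 0 := by
    intro k
    induction k using Nat.strong_induction_on with
    | _ k ih =>
      intro hk
      have hs := h k hk
      rw [Finset.sum_eq_single ⟨k, hk⟩] at hs
      · exact (mul_eq_zero.1 hs).resolve_right (hf ⟨k, hk⟩).2
      · intro i _ hi
        rcases lt_trichotomy (i : ℕ) k with hlt | heq | hgt
        · rw [ih i hlt i.2, zero_mul]
        · exact absurd (Fin.ext heq) hi
        · rw [(hf i).1 k hgt, mul_zero]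
      · simp
  funext i
  exact key i i.2

/-! ### Rolle's theorem and the zero count -/

/-- The integrating factor turns `d/dx - c` into an ordinary derivative, which opens the way to
Rolle's theorem. -/
lemma hasDerivAt_exp_neg_mul {f : ℝ → ℂ} (hf : Smooth f) (c : ℂ) (x : ℝ) :
    HasDerivAt (fun y : ℝ => Complex.exp (-c * y) * f y)
      (Complex.exp (-c * x) * shiftDeriv c f x) x := by
  have h1 : HasDerivAt (fun y : ℝ => -c * (y : ℂ)) (-c) x := by
    simpa using (Complex.ofRealCLM.hasDerivAt (x := x)).const_mul (-c)
  have h2 := h1.cexp.mul (hf.differentiable x).hasDerivAt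
  refine HasDerivAt.congr_deriv h2 ?_
  simp only [shiftDeriv]
  ring

lemma eq_zero_of_shiftDeriv_eq_zero {f : ℝ → ℂ} (hf : Smooth f) {c : ℂ}
    (h : ∀ x, shiftDeriv c f x = 0) {x₀ : ℝ} (h₀ : f x₀ = 0) (x : ℝ) : f x = 0 := by
  have h1 := is_const_of_deriv_eq_zero
    (fun y => (hasDerivAt_exp_neg_mul hf c y).differentiableAt)
    (fun y => by rw [(hasDerivAt_exp_neg_mul hf c y).deriv, h, mul_zero]) x x₀
  simpa [h₀, Complex.exp_ne_zero] using h1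

lemma shiftDeriv_im_eq_zero {f : ℝ → ℂ} (hf : Smooth f) (him : ∀ x, (f x).im = 0) {c : ℂ}
    (hc : c.im = 0) (x : ℝ) : (shiftDeriv c f x).im = 0 := by
  have h1 : HasDerivAt (fun y => (f y).im) (deriv f x).im x :=
    Complex.imCLM.hasFDerivAt.comp_hasDerivAt x (hf.differentiable x).hasDerivAt
  have h2 : (fun y => (f y).im) = fun _ => 0 := funext him
  rw [h2] at h1
  have h3 := h1.unique (hasDerivAt_const x (0 : ℝ))
  simp [shiftDeriv, h3, hc, him]

/-- Rolle's theorem for the real part of `e^{-cx} f`; as `c` and `f` are real, the exponential is a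
positive factor that can be cancelled. -/
lemma exists_shiftDeriv_eq_zero {f : ℝ → ℂ} (hf : Smooth f) (him : ∀ x, (f x).im = 0) {c : ℂ}
    (hc : c.im = 0) {u v : ℝ} (huv : u < v) (hu : f u = 0) (hv : f v = 0) :
    ∃ y ∈ Set.Ioo u v, shiftDeriv c f y = 0 := by
  have hd : ∀ x : ℝ, HasDerivAt (fun y : ℝ => (Complex.exp (-c * y) * f y).re)
      (Complex.exp (-c * x) * shiftDeriv c f x).re x := fun x =>
    Complex.reCLM.hasFDerivAt.comp_hasDerivAt x (hasDerivAt_exp_neg_mul hf c x)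
  obtain ⟨y, hy, hy0⟩ := exists_hasDerivAt_eq_zero huv
    (fun x _ => (hd x).continuousAt.continuousWithinAt) (by simp [hu, hv]) fun x _ => hd x
  refine ⟨y, hy, ?_⟩
  have hexp : (Complex.exp (-c * y)) = (Real.exp (-c.re * y) : ℂ) := by
    rw [Complex.ofReal_exp]
    congr 1
    apply Complex.ext <;> simp [hc]
  rw [hexp, Complex.re_ofReal_mul] at hy0
  exact Complex.ext ((mul_eq_zero.1 hy0).resolve_left (Real.exp_pos _).ne')
    (shiftDeriv_im_eq_zero hf him hc y)

lemma exists_finset_shiftDeriv_eq_zero {f : ℝ → ℂ} (hf : Smooth f) (him : ∀ x, (f x).im = 0)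
    {c : ℂ} (hc : c.im = 0) (T : Finset ℝ) (hT : ∀ x ∈ T, f x = 0) :
    ∃ T' : Finset ℝ, T.card ≤ T'.card + 1 ∧
      ∀ y ∈ T', shiftDeriv c f y = 0 ∧ ∃ u ∈ T, ∃ v ∈ T, u < y ∧ y < v := by
  induction T using Finset.induction_on_max with
  | empty => exact ⟨∅, by simp, by simp⟩
  | insert w T hw ih =>
    rcases T.eq_empty_or_nonempty with rfl | hne
    · exact ⟨∅, by simp, by simp⟩
    obtain ⟨T', hcard, hT'⟩ := ih fun x hx => hT x (Finset.mem_insert_of_mem hx)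
    have hmax := T.max'_mem hne
    obtain ⟨y, hy, hy0⟩ := exists_shiftDeriv_eq_zero hf him hc (hw _ hmax)
      (hT _ (Finset.mem_insert_of_mem hmax)) (hT _ (Finset.mem_insert_self _ _))
    -- Older zeros lie strictly below the old maximum, the new one strictly above it.
    have hyT : y ∉ T' := fun hmem => by
      obtain ⟨-, u, -, v, hv, -, hyv⟩ := hT' y hmem
      exact absurd (hyv.trans_le (T.le_max' v hv)) hy.1.not_gt
    refine ⟨insert y T', ?_, fun z hz => ?_⟩
    · rw [Finset.card_insert_of_notMem hyT,
        Finset.card_insert_of_notMem fun h => (hw w h).false]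
      omega
    · rcases Finset.mem_insert.1 hz with rfl | hz
      · exact ⟨hy0, _, Finset.mem_insert_of_mem hmax, w, Finset.mem_insert_self _ _, hy.1, hy.2⟩
      · obtain ⟨h0, u, hu, v, hv, huv⟩ := hT' z hz
        exact ⟨h0, u, Finset.mem_insert_of_mem hu, v, Finset.mem_insert_of_mem hv, huv⟩

/-- A zero of order `k > 0` at an endpoint leaves order `k - 1` for `f' - c f` and gives Rolle's
theorem one point; for `k = 0` it gives none, in line with truncated subtraction. -/
lemma exists_finset_of_order (k : ℕ) (a : ℝ) :
    ∃ A : Finset ℝ, (∀ y ∈ A, y = a ∧ 0 < k) ∧ k ≤ (k - 1) + A.card := by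
  rcases Nat.eq_zero_or_pos k with hk | hk
  · exact ⟨∅, by simp, by omega⟩
  · exact ⟨{a}, fun y hy => ⟨Finset.mem_singleton.1 hy, hk⟩, by
      rw [Finset.card_singleton]
      omega⟩

/-- A real-valued element of an `m`-dimensional space of exponential polynomials with real
eigenvalues vanishes identically if it has `m` zeros, counted with multiplicity at the endpoints
and without multiplicity in the interior of an interval. -/
lemma eq_zero_of_real_of_zeros {a b : ℝ} (hab : a < b) {m : ℕ} (Λ : Fin m → ℂ)
    (hΛ : ∀ i, (Λ i).im = 0) {f : ℝ → ℂ} (hf : f ∈ expPoly Λ) (him : ∀ x, (f x).im = 0)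
    {k l : ℕ} (ha : VanishesTo f k a) (hb : VanishesTo f l b) (S : Finset ℝ)
    (hS : ∀ x ∈ S, x ∈ Set.Ioo a b ∧ f x = 0) (hm : m ≤ k + l + S.card) (x : ℝ) : f x = 0 := by
  induction m generalizing f k l S x with
  | zero => exact hf.2 x
  | succ m ih =>
    have hsm : Smooth f := hf.1
    have hfa : 0 < k → f a = 0 := fun h => by simpa using ha 0 h
    have hfb : 0 < l → f b = 0 := fun h => by simpa using hb 0 h
    obtain ⟨A, hAmem, hcA⟩ := exists_finset_of_order k a
    obtain ⟨B, hBmem, hcB⟩ := exists_finset_of_order l b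
    have hdAS : Disjoint A S := Finset.disjoint_left.2 fun y hy hy' => by
      have h1 := (hS y hy').1.1
      rw [(hAmem y hy).1] at h1
      exact h1.false
    have hdB : Disjoint (A ∪ S) B := Finset.disjoint_left.2 fun y hy hy' => by
      rw [(hBmem y hy').1] at hy
      rcases Finset.mem_union.1 hy with hy | hy
      · exact hab.ne' (hAmem b hy).1
      · exact (hS b hy).1.2.false
    have hcard : ((A ∪ S) ∪ B).card = A.card + S.card + B.card := by
      rw [Finset.card_union_of_disjoint hdB, Finset.card_union_of_disjoint hdAS]
    have hmem : ∀ y ∈ (A ∪ S) ∪ B, y ∈ Set.Icc a b ∧ f y = 0 := by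
      intro y hy
      rcases Finset.mem_union.1 hy with hy | hy
      · rcases Finset.mem_union.1 hy with hy | hy
        · obtain ⟨rfl, h⟩ := hAmem y hy
          exact ⟨⟨le_rfl, hab.le⟩, hfa h⟩
        · exact ⟨Set.Ioo_subset_Icc_self (hS y hy).1, (hS y hy).2⟩
      · obtain ⟨rfl, h⟩ := hBmem y hy
        exact ⟨⟨hab.le, le_rfl⟩, hfb h⟩
    -- Rolle loses one zero against the distinct points, so the total count drops by one, as does
    -- the number of eigenvalues.
    obtain ⟨T', hT'card, hT'⟩ := exists_finset_shiftDeriv_eq_zero hsm him (hΛ 0)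
      ((A ∪ S) ∪ B) fun y hy => (hmem y hy).2
    have hzero := ih (Fin.tail Λ) (fun i => hΛ i.succ) (f := shiftDeriv (Λ 0) f)
      (delete_zero Λ ▸ shiftDeriv_mem_expPoly hf 0) (shiftDeriv_im_eq_zero hsm him (hΛ 0))
      (ha.shiftDeriv hsm (Λ 0)) (hb.shiftDeriv hsm (Λ 0)) T'
      (fun y hy => by
        obtain ⟨h0, u, hu, v, hv, huy, hyv⟩ := hT' y hy
        exact ⟨⟨(hmem u hu).1.1.trans_lt huy, hyv.trans_le (hmem v hv).1.2⟩, h0⟩)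
      (by omega)
    -- Only a multiple of `e^{λ_0 x}` remains possible; the count `m + 1` supplies a zero, which
    -- excludes a nonzero one.
    obtain ⟨x₀, hx₀⟩ : ∃ x₀, f x₀ = 0 := by
      rcases Nat.eq_zero_or_pos k with hk | hk
      · rcases Nat.eq_zero_or_pos l with hl | hl
        · obtain ⟨y, hy⟩ := Finset.card_pos.1 (show 0 < S.card by omega)
          exact ⟨y, (hS y hy).2⟩
        · exact ⟨b, hfb hl⟩
      · exact ⟨a, hfa hk⟩
    exact eq_zero_of_shiftDeriv_eq_zero hsm hzero hx₀ x

lemma deriv_clm_comp (L : ℂ →L[ℝ] ℂ) {f : ℝ → ℂ} (hf : Smooth f) :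
    deriv (L ∘ f) = L ∘ deriv f :=
  funext fun x => (L.hasFDerivAt.comp_hasDerivAt x (hf.differentiable x).hasDerivAt).deriv

lemma iteratedDeriv_clm_comp (L : ℂ →L[ℝ] ℂ) {f : ℝ → ℂ} (hf : Smooth f) (k : ℕ) (x : ℝ) :
    iteratedDeriv k (L ∘ f) x = L (iteratedDeriv k f x) := by
  induction k generalizing f with
  | zero => simp
  | succ k ih => rw [iteratedDeriv_succ', deriv_clm_comp L hf, ih hf.deriv, ← iteratedDeriv_succ']

lemma diffOp_clm_comp (L : ℂ →L[ℝ] ℂ) {f : ℝ → ℂ} (hf : Smooth f) {m : ℕ} (Λ : Fin m → ℂ)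
    (hΛ : ∀ i, (Λ i).im = 0) : diffOp Λ (L ∘ f) = L ∘ diffOp Λ f := by
  induction m with
  | zero => rfl
  | succ m ih =>
    have h0 : Λ 0 = ((Λ 0).re : ℂ) := Complex.ext (by simp) (by simp [hΛ])
    rw [diffOp_succ, ih (Fin.tail Λ) fun i => hΛ i.succ, diffOp_succ]
    funext x
    simp only [shiftDeriv, deriv_clm_comp L (hf.diffOp _), Function.comp_apply, map_sub]
    rw [h0, ← Complex.real_smul, ← Complex.real_smul, map_smul]

/-- Real eigenvalues let the operator commute with real-linear maps, so the real zero count applies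
to `L ∘ f`, viewed as a complex function with real values. -/
lemma clm_comp_eq_zero {a b : ℝ} (hab : a < b) {m : ℕ} {Λ : Fin m → ℂ}
    (hΛ : ∀ i, (Λ i).im = 0) {f : ℝ → ℂ} (hf : f ∈ expPoly Λ)
    {k l : ℕ} (ha : VanishesTo f k a) (hb : VanishesTo f l b) (hm : m ≤ k + l)
    (L : ℂ →L[ℝ] ℝ) (x : ℝ) : L (f x) = 0 := by
  have hsm : Smooth f := hf.1
  set L' : ℂ →L[ℝ] ℂ := Complex.ofRealCLM.comp L
  have h := eq_zero_of_real_of_zeros hab Λ hΛ (f := L' ∘ f) (k := k) (l := l)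
    ⟨L'.contDiff.comp hsm, fun y => by simp [diffOp_clm_comp L' hsm Λ hΛ, hf.2 y]⟩
    (fun y => by simp [L'])
    (fun i hi => by rw [iteratedDeriv_clm_comp L' hsm, ha i hi, map_zero])
    (fun i hi => by rw [iteratedDeriv_clm_comp L' hsm, hb i hi, map_zero]) ∅ (by simp)
    (by simpa using hm) x
  simpa [L'] using h

lemma eq_zero_of_vanishesTo {a b : ℝ} (hab : a < b) {m : ℕ} {Λ : Fin m → ℂ}
    (hΛ : ∀ i, (Λ i).im = 0) {f : ℝ → ℂ} (hf : f ∈ expPoly Λ)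
    {k l : ℕ} (ha : VanishesTo f k a) (hb : VanishesTo f l b) (hm : m ≤ k + l) : f = 0 :=
  funext fun x => Complex.ext (clm_comp_eq_zero hab hΛ hf ha hb hm Complex.reCLM x)
    (clm_comp_eq_zero hab hΛ hf ha hb hm Complex.imCLM x)

/-! ### Existence and uniqueness of the Bernstein functions -/

lemma smooth_exp_mul (c : ℂ) : Smooth (fun x : ℝ => Complex.exp (c * x)) :=
  Complex.contDiff_exp.comp (contDiff_const.mul Complex.ofRealCLM.contDiff)

lemma hasDerivAt_exp_mul (c : ℂ) (x : ℝ) :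
    HasDerivAt (fun y : ℝ => Complex.exp (c * y)) (c * Complex.exp (c * x)) x := by
  have h1 : HasDerivAt (fun y : ℝ => c * (y : ℂ)) c x := by
    simpa using (Complex.ofRealCLM.hasDerivAt (x := x)).const_mul c
  simpa [mul_comm] using h1.cexp

/-- Variation of constants: `f(x) = e^{cx} ∫_a^x e^{-cs} h(s) ds`. -/
lemma exists_shiftDeriv_eq {h : ℝ → ℂ} (hh : Smooth h) (c : ℂ) (a : ℝ) :
    ∃ f, Smooth f ∧ shiftDeriv c f = h ∧ f a = 0 := by
  set u : ℝ → ℂ := fun s => Complex.exp (-c * s) * h s with hu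
  have hus : Smooth u := (smooth_exp_mul (-c)).mul hh
  set F : ℝ → ℂ := fun x => ∫ s in a..x, u s with hF
  have hd : ∀ x, HasDerivAt F (u x) x := fun x =>
    (hus.continuous).integral_hasStrictDerivAt a x |>.hasDerivAt
  have hFs : Smooth F := by
    refine contDiff_infty_iff_deriv.2 ⟨fun x => (hd x).differentiableAt, ?_⟩
    rw [show deriv F = u from funext fun x => (hd x).deriv]
    exact hus
  refine ⟨fun x => Complex.exp (c * x) * F x, (smooth_exp_mul c).mul hFs, ?_, ?_⟩
  · funext x
    have h1 := ((hasDerivAt_exp_mul c x).mul (hd x)).deriv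
    have h2 : Complex.exp (c * x) * Complex.exp (-c * x) = 1 := by
      rw [← Complex.exp_add]
      simp
    change deriv ((fun y : ℝ => Complex.exp (c * y)) * F) x - c * (Complex.exp (c * x) * F x) = h x
    rw [h1]
    linear_combination h x * h2
  · simp [hF]

lemma iteratedDeriv_succ_of_shiftDeriv {f : ℝ → ℂ} (hf : Smooth f) (c : ℂ) {k : ℕ} {x : ℝ}
    (hk : VanishesTo (shiftDeriv c f) k x) (h0 : f x = 0) :
    VanishesTo f (k + 1) x ∧
      iteratedDeriv (k + 1) f x = iteratedDeriv k (shiftDeriv c f) x := by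
  have hv : VanishesTo f (k + 1) x := by
    intro i
    induction i with
    | zero => intro _; simpa using h0
    | succ i ih =>
      intro hi
      have h1 := iteratedDeriv_shiftDeriv hf c i x
      rw [hk i (by omega), ih (by omega)] at h1
      simpa using h1.symm
  refine ⟨hv, ?_⟩
  rw [iteratedDeriv_shiftDeriv hf, hv k k.lt_succ_self]
  simp

/-- An exponential has order `0` at `a`; solving `f' - λ_0 f = g_i` with `f(a) = 0` raises each
order of the previous family by one. -/
lemma exists_mem_expPoly_order {m : ℕ} (Λ : Fin m → ℂ) (a : ℝ) :
    ∃ g : Fin m → ℝ → ℂ, ∀ i, g i ∈ expPoly Λ ∧ HasZeroOfOrder (g i) i a := by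
  induction m with
  | zero => exact ⟨fun _ => 0, fun i => i.elim0⟩
  | succ m ih =>
    obtain ⟨g, hg⟩ := ih (Fin.tail Λ)
    choose f hfs hfd hfa using fun i => exists_shiftDeriv_eq (hg i).1.1 (Λ 0) a
    refine ⟨Fin.cons (fun x : ℝ => Complex.exp (Λ 0 * x)) f, Fin.cases ?_ fun i => ?_⟩
    · simp only [Fin.cons_zero]
      refine ⟨mem_expPoly_of_shiftDeriv (smooth_exp_mul _) 0 ?_, by simp, by simp⟩
      rw [show shiftDeriv (Λ 0) (fun x : ℝ => Complex.exp (Λ 0 * x)) = 0 from funext fun x => by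
        simp only [shiftDeriv, (hasDerivAt_exp_mul (Λ 0) x).deriv, sub_self, Pi.zero_apply]]
      exact (expPolySubmodule (delete Λ 0)).zero_mem
    · simp only [Fin.cons_succ]
      refine ⟨mem_expPoly_of_shiftDeriv (hfs i) 0 ?_, ?_⟩
      · rw [hfd, delete_zero]
        exact (hg i).1
      · have := iteratedDeriv_succ_of_shiftDeriv (hfs i) (Λ 0) (k := i) (x := a)
          (by rw [hfd]; exact (hg i).2.1) (hfa i)
        rw [hfd] at this
        refine ⟨this.1, ?_⟩
        rw [Fin.val_succ, this.2]
        exact (hg i).2.2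

lemma sum_smul_mem_expPoly {m : ℕ} {Λ : Fin m → ℂ} {ι : Type*} (s : Finset ι) (c : ι → ℂ)
    {f : ι → ℝ → ℂ} (hf : ∀ i ∈ s, f i ∈ expPoly Λ) : ∑ i ∈ s, c i • f i ∈ expPoly Λ :=
  (expPolySubmodule Λ).sum_mem fun i hi => (expPolySubmodule Λ).smul_mem _ (hf i hi)

/-- Two-point Hermite interpolation is a square linear system. The zero count and the independence
of the `g i` make it injective, hence surjective. -/
lemma exists_mem_expPoly_vanishesTo {a b : ℝ} (hab : a < b) {m : ℕ} {Λ : Fin m → ℂ}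
    (hΛ : ∀ i, (Λ i).im = 0) {k : ℕ} (hk : k < m) :
    ∃ g ∈ expPoly Λ, VanishesTo g k a ∧ VanishesTo g (m - 1 - k) b ∧ iteratedDeriv k g a = 1 := by
  obtain ⟨g, hg⟩ := exists_mem_expPoly_order Λ a
  have hsm : ∀ i ∈ Finset.univ, Smooth (g i) := fun i _ => (hg i).1.1
  -- Rows `0, …, k` are derivatives at `a`; the remaining `m - 1 - k` rows are derivatives at `b`,
  -- starting from order `0`.
  let M : Matrix (Fin m) (Fin m) ℂ := fun i l =>
    if (i : ℕ) ≤ k then iteratedDeriv i (g l) a else iteratedDeriv (i - (k + 1)) (g l) b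
  have hM : ∀ c i, M.mulVec c i = if (i : ℕ) ≤ k then iteratedDeriv i (∑ l, c l • g l) a
      else iteratedDeriv (i - (k + 1)) (∑ l, c l • g l) b := by
    intro c i
    change ∑ l, M i l * c l = _
    split_ifs with h <;>
    · rw [iteratedDeriv_sum_smul _ _ hsm]
      refine Finset.sum_congr rfl fun l _ => ?_
      simp [M, h, mul_comm]
  have hright : ∀ c, (∀ i : Fin m, k < i → M.mulVec c i = 0) →
      VanishesTo (∑ l, c l • g l) (m - 1 - k) b := by
    intro c hc i hi
    have h := hc ⟨i + (k + 1), by omega⟩ (by simp only; omega)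
    rw [hM, if_neg (by simp only; omega)] at h
    simpa using h
  have hinj : Function.Injective (Matrix.mulVecLin M) := by
    refine (injective_iff_map_eq_zero _).2 fun c hc => ?_
    have hc' : ∀ i, M.mulVec c i = 0 := fun i => congrFun hc i
    have hzero := eq_zero_of_vanishesTo hab hΛ
      (sum_smul_mem_expPoly Finset.univ c fun i _ => (hg i).1) (k := k + 1) (l := m - 1 - k)
      (fun i hi => by
        have h := hc' ⟨i, by omega⟩
        rwa [hM, if_pos (by simp only; omega)] at h)
      (hright c fun i _ => hc' i) (by omega)
    refine eq_zero_of_iteratedDeriv_sum_eq_zero (fun i => (hg i).2) c fun i _ => ?_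
    rw [← iteratedDeriv_sum_smul _ _ hsm, hzero]
    simp
  obtain ⟨c, hc⟩ := (LinearMap.injective_iff_surjective.1 hinj) (Pi.single ⟨k, hk⟩ 1)
  have hc' : ∀ i, M.mulVec c i = (Pi.single ⟨k, hk⟩ 1 : Fin m → ℂ) i := fun i => congrFun hc i
  refine ⟨_, sum_smul_mem_expPoly Finset.univ c fun i _ => (hg i).1, fun i hi => ?_,
    hright c fun i hi => ?_, ?_⟩
  · have h := hc' ⟨i, by omega⟩
    rwa [hM, if_pos (by simp only; omega), Pi.single_eq_of_ne
      (fun h => by simp only [Fin.mk.injEq] at h; omega)] at h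
  · rw [hc', Pi.single_eq_of_ne fun h => by rw [h] at hi; exact hi.false]
  · have h := hc' ⟨k, hk⟩
    rwa [hM, if_pos le_rfl, Pi.single_eq_same] at h

lemma existsUnique_isBernsteinFunction {a b : ℝ} (hab : a < b) {m : ℕ} {Λ : Fin m → ℂ}
    (hΛ : ∀ i, (Λ i).im = 0) {k : ℕ} (hk : k < m) : ∃! g, IsBernsteinFunction Λ a b k g := by
  obtain ⟨g, hg, ha, hb, h1⟩ := exists_mem_expPoly_vanishesTo hab hΛ hk
  refine ⟨g, ⟨hg, ⟨ha, by rw [h1]; exact one_ne_zero⟩, ⟨hb, fun h => ?_⟩, h1⟩, fun f hf => ?_⟩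
  -- One more order at `b` would bring the count to `m`, contradicting the normalization at `a`.
  · have h0 := eq_zero_of_vanishesTo hab hΛ hg ha (VanishesTo.succ hb h) (by omega)
    rw [h0] at h1
    simp at h1
  · have hfs : Smooth f := hf.mem.1
    have hgs : Smooth g := hg.1
    have h0 := eq_zero_of_vanishesTo hab hΛ
      ((expPolySubmodule Λ).add_mem hf.mem ((expPolySubmodule Λ).smul_mem (-1) hg))
      (VanishesTo.succ (VanishesTo.add_smul hfs hgs hf.zero_left.1 ha (-1)) (by
        rw [iteratedDeriv_add_smul hfs hgs, h1, hf.normalized]; ring))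
      (VanishesTo.add_smul hfs hgs hf.zero_right.1 hb (-1)) (by omega)
    rw [neg_one_smul, ← sub_eq_add_neg] at h0
    exact sub_eq_zero.1 h0

lemma isBernsteinFunction_bernsteinFun {a b : ℝ} (hab : a < b) {m : ℕ} {Λ : Fin m → ℂ}
    (hΛ : ∀ i, (Λ i).im = 0) {k : ℕ} (hk : k < m) :
    IsBernsteinFunction Λ a b k (bernsteinFun Λ a b k) := by
  have h := (existsUnique_isBernsteinFunction hab hΛ hk).exists
  rw [bernsteinFun, dif_pos h]
  exact h.choose_spec

/-! ### Limits of quotients at a common zero -/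

/-- In the Taylor polynomial of degree `r` only the leading term survives. -/
lemma tendsto_inv_pow_smul {f : ℝ → ℂ} (hf : Smooth f) {r : ℕ} {c : ℝ} (h : VanishesTo f r c) :
    Tendsto (fun x => ((x - c) ^ r)⁻¹ • f x) (𝓝[≠] c)
      (𝓝 ((r.factorial : ℝ)⁻¹ • iteratedDeriv r f c)) := by
  have h1 := ((taylor_isLittleO_univ (hf.contDiff_nat r) (x₀ := c)).mono
    (nhdsWithin_le_nhds (s := {c}ᶜ))).tendsto_inv_smul_nhds_zero
  rw [← tendsto_sub_nhds_zero_iff]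
  refine h1.congr' ?_
  filter_upwards [self_mem_nhdsWithin] with x hx
  have hx' : (x - c) ^ r ≠ 0 := pow_ne_zero _ (sub_ne_zero.2 hx)
  rw [taylor_within_apply, Finset.sum_range_succ, Finset.sum_eq_zero, zero_add, smul_sub,
    iteratedDerivWithin_univ, smul_smul]
  · congr 2
    field_simp
  · intro i hi
    rw [iteratedDerivWithin_univ, h i (Finset.mem_range.1 hi), smul_zero]

lemma tendsto_div_nhds_zero {f g : ℝ → ℂ} (hf : Smooth f) (hg : Smooth g) {r : ℕ} {c : ℝ}
    (h : VanishesTo f (r + 1) c) (h' : HasZeroOfOrder g r c) :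
    Tendsto (fun x => f x / g x) (𝓝[≠] c) (𝓝 0) := by
  have hne : (r.factorial : ℝ)⁻¹ • iteratedDeriv r g c ≠ 0 :=
    smul_ne_zero (inv_ne_zero (Nat.cast_ne_zero.2 r.factorial_ne_zero)) h'.2
  have h1 := (tendsto_inv_pow_smul hf (h.mono r.le_succ)).div (tendsto_inv_pow_smul hg h'.1) hne
  rw [h r r.lt_succ_self, smul_zero, zero_div] at h1
  refine h1.congr' ?_
  filter_upwards [self_mem_nhdsWithin] with x hx
  have hx' : ((x - c) ^ r : ℝ) ≠ 0 := pow_ne_zero _ (sub_ne_zero.2 hx)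
  simp only [Pi.div_apply, Complex.real_smul]
  rw [mul_div_mul_left _ _ (Complex.ofReal_ne_zero.2 (inv_ne_zero hx'))]

lemma eventually_ne_zero_of_order {g : ℝ → ℂ} (hg : Smooth g) {r : ℕ} {c : ℝ}
    (h : HasZeroOfOrder g r c) : ∀ᶠ x in 𝓝[≠] c, g x ≠ 0 := by
  have hne : (r.factorial : ℝ)⁻¹ • iteratedDeriv r g c ≠ 0 :=
    smul_ne_zero (inv_ne_zero (Nat.cast_ne_zero.2 r.factorial_ne_zero)) h.2
  filter_upwards [(tendsto_inv_pow_smul hg h.1).eventually_ne hne] with x hx h0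
  simp [h0] at hx

lemma mem_expPoly_add_smul {m : ℕ} {Λ : Fin m → ℂ} {f g : ℝ → ℂ} (hf : f ∈ expPoly Λ)
    (hg : g ∈ expPoly Λ) (c : ℂ) : f + c • g ∈ expPoly Λ :=
  (expPolySubmodule Λ).add_mem hf ((expPolySubmodule Λ).smul_mem c hg)

/-- An element of the space with zeros of order `k` at `a` and `m - 1 - k` at `b` is a multiple of
the `k`-th Bernstein basis function. -/
lemma eq_smul_bernsteinFun {a b : ℝ} (hab : a < b) {m : ℕ} {Λ : Fin m → ℂ}
    (hΛ : ∀ i, (Λ i).im = 0) {k : ℕ} (hk : k < m) {f : ℝ → ℂ} (hf : f ∈ expPoly Λ)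
    (ha : VanishesTo f k a) (hb : VanishesTo f (m - 1 - k) b) :
    f = iteratedDeriv k f a • bernsteinFun Λ a b k := by
  have hq := isBernsteinFunction_bernsteinFun hab hΛ hk
  have hfs : Smooth f := hf.1
  have hqs : Smooth (bernsteinFun Λ a b k) := hq.mem.1
  have h0 := eq_zero_of_vanishesTo hab hΛ (mem_expPoly_add_smul hf hq.mem (-iteratedDeriv k f a))
    (VanishesTo.succ (VanishesTo.add_smul hfs hqs ha hq.zero_left.1 _) (by
      rw [iteratedDeriv_add_smul hfs hqs, hq.normalized]; ring))
    (VanishesTo.add_smul hfs hqs hb hq.zero_right.1 _) (by omega)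
  rwa [neg_smul, ← sub_eq_add_neg, sub_eq_zero] at h0

/-! ### The two-term derivative formula -/

variable {n : ℕ} {Λ : Fin (n + 1) → ℂ} {a b : ℝ}

/-- The Bernstein basis function of index `k - 1`, and the zero function if `k = 0`. -/
noncomputable def bernsteinFunPred {m : ℕ} (Λ : Fin m → ℂ) (a b : ℝ) : ℕ → ℝ → ℂ
  | 0 => 0
  | k + 1 => bernsteinFun Λ a b k

lemma bernsteinFunPred_mem (hab : a < b) {m : ℕ} {Λ : Fin m → ℂ} (hΛ : ∀ i, (Λ i).im = 0) {k : ℕ}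
    (hk : k ≤ m) : bernsteinFunPred Λ a b k ∈ expPoly Λ ∧
      VanishesTo (bernsteinFunPred Λ a b k) (m - k) b := by
  cases k with
  | zero => exact ⟨(expPolySubmodule Λ).zero_mem, fun i _ => by simp [bernsteinFunPred]⟩
  | succ k =>
    have hq := isBernsteinFunction_bernsteinFun hab hΛ hk
    refine ⟨hq.mem, ?_⟩
    have h := hq.zero_right.1
    rwa [show m - 1 - k = m - (k + 1) by omega] at h

/-- For `k > 0` both functions have order `k - 1` at `a` with derivative `1` there, so the leading
terms cancel. -/
lemma vanishesTo_shiftDeriv_sub (hab : a < b) (hΛ : ∀ i, (Λ i).im = 0) (j : Fin (n + 1)) {k : ℕ}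
    (hk : k ≤ n) :
    VanishesTo (shiftDeriv (Λ j) (bernsteinFun Λ a b k) +
      (-1 : ℂ) • bernsteinFunPred (delete Λ j) a b k) k a := by
  cases k with
  | zero => exact fun i hi => absurd hi (Nat.not_lt_zero i)
  | succ k =>
    have hp := isBernsteinFunction_bernsteinFun hab hΛ (Nat.lt_succ_of_le hk)
    have hq := isBernsteinFunction_bernsteinFun hab (Λ := delete Λ j) (fun i => hΛ _) hk
    have hps : Smooth (bernsteinFun Λ a b (k + 1)) := hp.mem.1
    have hqs : Smooth (bernsteinFun (delete Λ j) a b k) := hq.mem.1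
    refine VanishesTo.succ (VanishesTo.add_smul (hps.shiftDeriv _) hqs
      (VanishesTo.shiftDeriv hps hp.zero_left.1 _) hq.zero_left.1 _) ?_
    rw [bernsteinFunPred, iteratedDeriv_add_smul (hps.shiftDeriv _) hqs,
      iteratedDeriv_shiftDeriv hps, hp.normalized, hp.zero_left.1 k k.lt_succ_self, hq.normalized]
    ring

/-- The derivative of the last basis function. -/
lemma shiftDeriv_bernsteinFun_last (hab : a < b) (hΛ : ∀ i, (Λ i).im = 0) (j : Fin (n + 1)) :
    shiftDeriv (Λ j) (bernsteinFun Λ a b n) = bernsteinFunPred (delete Λ j) a b n := by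
  have hp := isBernsteinFunction_bernsteinFun hab hΛ n.lt_succ_self
  have hP := bernsteinFunPred_mem hab (Λ := delete Λ j) (fun i => hΛ _) le_rfl
  have h0 := eq_zero_of_vanishesTo hab (Λ := delete Λ j) (fun i => hΛ _)
    (mem_expPoly_add_smul (shiftDeriv_mem_expPoly hp.mem j) hP.1 (-1))
    (vanishesTo_shiftDeriv_sub hab hΛ j le_rfl) (l := 0)
    (fun i hi => absurd hi (Nat.not_lt_zero i)) (by omega)
  rwa [neg_one_smul, ← sub_eq_add_neg, sub_eq_zero] at h0

/-- Two-term expansion of `p_{Λ,k}' - λ_j p_{Λ,k}`, and the limit that gives its coefficient. -/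
lemma exists_shiftDeriv_bernsteinFun (hab : a < b) (hΛ : ∀ i, (Λ i).im = 0) (j : Fin (n + 1))
    {k : ℕ} (hk : k < n) :
    ∃ d : ℂ, shiftDeriv (Λ j) (bernsteinFun Λ a b k) =
        bernsteinFunPred (delete Λ j) a b k + d • bernsteinFun (delete Λ j) a b k ∧
      Tendsto (derivQuotient Λ a b j k) (𝓝[≠] b) (𝓝 d) := by
  have hp := isBernsteinFunction_bernsteinFun hab hΛ (hk.trans n.lt_succ_self)
  have hq := isBernsteinFunction_bernsteinFun hab (Λ := delete Λ j) (fun i => hΛ _) hk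
  have hP := bernsteinFunPred_mem hab (Λ := delete Λ j) (fun i => hΛ _) hk.le
  have hps : Smooth (bernsteinFun Λ a b k) := hp.mem.1
  have hqs : Smooth (bernsteinFun (delete Λ j) a b k) := hq.mem.1
  have hPs : Smooth (bernsteinFunPred (delete Λ j) a b k) := hP.1.1
  have hpb : VanishesTo (bernsteinFun Λ a b k) (n - k) b := hp.zero_right.1
  have h0 := eq_smul_bernsteinFun hab (Λ := delete Λ j) (fun i => hΛ _) hk
    (mem_expPoly_add_smul (shiftDeriv_mem_expPoly hp.mem j) hP.1 (-1))
    (vanishesTo_shiftDeriv_sub hab hΛ j hk.le)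
    (VanishesTo.add_smul (hps.shiftDeriv _) hPs
      ((VanishesTo.shiftDeriv hps hpb _).mono (by omega)) (hP.2.mono (by omega)) (-1))
  set d := iteratedDeriv k (shiftDeriv (Λ j) (bernsteinFun Λ a b k) +
    (-1 : ℂ) • bernsteinFunPred (delete Λ j) a b k) a
  have hd : shiftDeriv (Λ j) (bernsteinFun Λ a b k) =
      bernsteinFunPred (delete Λ j) a b k + d • bernsteinFun (delete Λ j) a b k := by
    rw [← h0]
    module
  refine ⟨d, hd, ?_⟩
  -- By `hd`, `p_k' = (q_{k-1} + λ_j p_k) + d q_k`; the bracket vanishes at `b` to order `n - k`,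
  -- against `n - 1 - k` for `q_k`.
  have hlim := tendsto_div_nhds_zero (hPs.add_smul hps (Λ j)) hqs (r := n - 1 - k) (c := b)
    ((VanishesTo.add_smul hPs hps hP.2 hpb (Λ j)).mono (by omega)) hq.zero_right
  have hlim' := hlim.const_add d
  rw [add_zero] at hlim'
  refine hlim'.congr' ?_
  filter_upwards [eventually_ne_zero_of_order hqs hq.zero_right] with x hx
  have hx' := congrFun hd x
  simp only [shiftDeriv, Pi.add_apply, Pi.smul_apply, smul_eq_mul] at hx'
  simp only [derivQuotient, Pi.add_apply, Pi.smul_apply, smul_eq_mul]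
  field_simp
  linear_combination -hx'

lemma tendsto_derivQuotient (hab : a < b) (hΛ : ∀ i, (Λ i).im = 0) (j : Fin (n + 1))
    {k : ℕ} (hk : k < n) :
    Tendsto (derivQuotient Λ a b j k) (𝓝[≠] b) (𝓝 (dCoeff Λ a b j k)) := by
  obtain ⟨d, -, h⟩ := exists_shiftDeriv_bernsteinFun hab hΛ j hk
  exact tendsto_nhds_limUnder ⟨d, h⟩

lemma shiftDeriv_bernsteinFun (hab : a < b) (hΛ : ∀ i, (Λ i).im = 0) (j : Fin (n + 1))
    {k : ℕ} (hk : k < n) :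
    shiftDeriv (Λ j) (bernsteinFun Λ a b k) = bernsteinFunPred (delete Λ j) a b k +
      dCoeff Λ a b j k • bernsteinFun (delete Λ j) a b k := by
  obtain ⟨d, hd, h⟩ := exists_shiftDeriv_bernsteinFun hab hΛ j hk
  rwa [show dCoeff Λ a b j k = d from h.limUnder_eq]

lemma smooth_bernsteinFun (hab : a < b) (hΛ : ∀ i, (Λ i).im = 0) (k : Fin (n + 1)) :
    Smooth (bernsteinFun Λ a b k) :=
  (isBernsteinFunction_bernsteinFun hab hΛ k.2).mem.1

lemma shiftDeriv_sum_smul {ι : Type*} (s : Finset ι) (y : ι → ℂ) {f : ι → ℝ → ℂ}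
    (hf : ∀ i ∈ s, Smooth (f i)) (c : ℂ) (x : ℝ) :
    shiftDeriv c (∑ i ∈ s, y i • f i) x = ∑ i ∈ s, y i * shiftDeriv c (f i) x := by
  have h := iteratedDeriv_sum_smul s y hf 1 x
  simp only [iteratedDeriv_one] at h
  simp only [shiftDeriv, h, Finset.sum_apply, Pi.smul_apply, smul_eq_mul, Finset.mul_sum,
    ← Finset.sum_sub_distrib]
  exact Finset.sum_congr rfl fun i _ => by ring

/-- The first order operator `d/dx - λ_j` applied to a combination of Bernstein basis functions. -/
lemma shiftDeriv_sum_bernsteinFun (hab : a < b) (hΛ : ∀ i, (Λ i).im = 0) (j : Fin (n + 1))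
    (y : Fin (n + 1) → ℂ) (x : ℝ) :
    shiftDeriv (Λ j) (∑ k, y k • bernsteinFun Λ a b k) x =
      ∑ k : Fin n, (dCoeff Λ a b j k * y k.castSucc + y k.succ) *
        bernsteinFun (delete Λ j) a b k x := by
  rw [shiftDeriv_sum_smul _ _ fun k _ => smooth_bernsteinFun hab hΛ k]
  have h1 : ∑ k : Fin (n + 1), y k * shiftDeriv (Λ j) (bernsteinFun Λ a b k) x =
      ∑ k : Fin (n + 1), y k * bernsteinFunPred (delete Λ j) a b k x +
        ∑ k : Fin n, y k.castSucc * (dCoeff Λ a b j k * bernsteinFun (delete Λ j) a b k x) := by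
    rw [Fin.sum_univ_castSucc, Fin.sum_univ_castSucc (n := n)
      (f := fun k => y k * bernsteinFunPred (delete Λ j) a b k x)]
    simp only [Fin.val_last, shiftDeriv_bernsteinFun_last hab hΛ, Fin.val_castSucc,
      fun k : Fin n => shiftDeriv_bernsteinFun hab hΛ j k.2, Pi.add_apply, Pi.smul_apply,
      smul_eq_mul, mul_add, Finset.sum_add_distrib]
    ring
  rw [h1, Fin.sum_univ_succ]
  simp only [Fin.val_zero, bernsteinFunPred, Pi.zero_apply, mul_zero, zero_add, Fin.val_succ,
    ← Finset.sum_add_distrib]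
  exact Finset.sum_congr rfl fun k _ => by ring

/-! ### Weights from the reproduction of constants -/

/-- Derivatives vanish inside the interval and extend to `a` by continuity. This is needed because
reproduction is known only on `[a, b]`, while coefficients are read off at `a`. -/
lemma iteratedDeriv_eq_zero_of_Ioo {f : ℝ → ℂ} (hf : Smooth f) (hab : a < b)
    (h : ∀ x ∈ Set.Ioo a b, f x = 0) (k : ℕ) : iteratedDeriv k f a = 0 := by
  have h1 : Set.Ioo a b ⊆ {x | iteratedDeriv k f x = 0} := by
    intro x hx
    have he : f =ᶠ[𝓝 x] fun _ => 0 := by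
      filter_upwards [Ioo_mem_nhds hx.1 hx.2] with y hy using h y hy
    change iteratedDeriv k f x = 0
    rw [he.iteratedDeriv_eq, iteratedDeriv_fun_const_zero]
  have hcl : IsClosed {x | iteratedDeriv k f x = 0} :=
    isClosed_eq ((hf.contDiff_nat k).continuous_iteratedDeriv k le_rfl) continuous_const
  have h2 := closure_minimal h1 hcl
  rw [closure_Ioo hab.ne] at h2
  exact h2 ⟨le_rfl, hab.le⟩

lemma bernsteinOp_eq_sum (Λ : Fin (n + 1) → ℂ) (a b : ℝ) (t : Fin (n + 1) → Set.Icc a b)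
    (α : Fin (n + 1) → ℝ) (f : Set.Icc a b → ℂ) :
    bernsteinOp Λ a b t α f = ∑ k, ((α k : ℂ) * f (t k)) • bernsteinFun Λ a b k := by
  funext x
  simp [bernsteinOp]

/-- Reproduction of constants determines the quotients of consecutive weights. -/
lemma weight_succ (hab : a < b) (hΛ : ∀ i, (Λ i).im = 0) (h0 : Λ 0 = 0)
    {t : Fin (n + 1) → Set.Icc a b} {α : Fin (n + 1) → ℝ} (hB : IsBernsteinData Λ a b t α)
    (k : Fin n) : (α k.succ : ℂ) = -(dCoeff Λ a b 0 k * α k.castSucc) := by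
  have hq := fun k : Fin n =>
    isBernsteinFunction_bernsteinFun hab (Λ := delete Λ 0) (fun i => hΛ _) k.2
  -- These are the coefficients of `(∑ α_k p_k)'` in the basis with `λ_0` deleted; the sum is `1` on
  -- `[a, b]`, so they must vanish.
  set c : Fin n → ℂ := fun k => dCoeff Λ a b 0 k * α k.castSucc + α k.succ with hc
  have hsm : ∀ i ∈ Finset.univ, Smooth (bernsteinFun (delete Λ 0) a b (i : Fin n)) :=
    fun i _ => (hq i).mem.1
  have hzero : ∀ x ∈ Set.Ioo a b, (∑ k, c k • bernsteinFun (delete Λ 0) a b (k : Fin n)) x = 0 := by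
    intro x hx
    have h1 := shiftDeriv_sum_bernsteinFun hab hΛ 0 (fun k => (α k : ℂ)) x
    have he : (∑ k : Fin (n + 1), (α k : ℂ) • bernsteinFun Λ a b k) =ᶠ[𝓝 x] fun _ => 1 := by
      filter_upwards [Ioo_mem_nhds hx.1 hx.2] with y hy
      have := hB.reproduces_zero y (Set.Ioo_subset_Icc_self hy)
      simpa [h0, bernsteinOp] using this
    rw [shiftDeriv, he.deriv_eq, h0] at h1
    simpa using h1.symm
  have hsmooth : Smooth (∑ k, c k • bernsteinFun (delete Λ 0) a b (k : Fin n)) :=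
    (sum_smul_mem_expPoly Finset.univ c fun i _ => (hq i).mem).1
  have hcz := eq_zero_of_iteratedDeriv_sum_eq_zero (fun i => (hq i).zero_left) c fun i _ => by
    rw [← iteratedDeriv_sum_smul _ _ hsm]
    exact iteratedDeriv_eq_zero_of_Ioo hsmooth hab hzero i
  have hk := congrFun hcz k
  simp only [hc, Pi.zero_apply] at hk
  linear_combination hk

end ExpBernstein

theorem mainTheorem12 {n : ℕ} (hn : 1 ≤ n) (Λ : Fin (n + 1) → ℂ)
    (hreal : ∀ i, (Λ i).im = 0) (h0 : Λ 0 = 0) (h01 : Λ 0 ≠ Λ 1)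
    {a b : ℝ} (hab : a < b)
    (t : Fin (n + 1) → Set.Icc a b) (α : Fin (n + 1) → ℝ)
    (hB : IsBernsteinData Λ a b t α) (j : Fin (n + 1)) :
    -- the Bernstein basis functions exist and are unique
    (∀ k ≤ n, ∃! g, IsBernsteinFunction Λ a b k g) ∧
    (∀ k < n, ∃! g, IsBernsteinFunction (delete Λ j) a b k g) ∧
    -- the limits defining the numbers `d` exist
    (∀ k < n, Tendsto (derivQuotient Λ a b j k) (𝓝[≠] b) (𝓝 (dCoeff Λ a b j k))) ∧
    (∀ k < n, Tendsto (derivQuotient Λ a b 0 k) (𝓝[≠] b) (𝓝 (dCoeff Λ a b 0 k))) ∧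
    -- the derivative formula
    ∀ (f : C(Set.Icc a b, ℂ)) (x : ℝ),
      deriv (bernsteinOp Λ a b t α f) x - Λ j * bernsteinOp Λ a b t α f x =
        ∑ k : Fin n, diffΔ Λ a b j (fun i => f (t i)) k * (α k.castSucc : ℂ) *
          bernsteinFun (delete Λ j) a b k x := by
  refine ⟨fun k hk => existsUnique_isBernsteinFunction hab hreal (Nat.lt_succ_of_le hk),
    fun k hk => existsUnique_isBernsteinFunction hab (fun i => hreal _) hk,
    fun k hk => tendsto_derivQuotient hab hreal j hk,
    fun k hk => tendsto_derivQuotient hab hreal 0 hk, fun f x => ?_⟩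
  have h := shiftDeriv_sum_bernsteinFun hab hreal j (fun k => (α k : ℂ) * f (t k)) x
  rw [← bernsteinOp_eq_sum] at h
  refine h.trans (Finset.sum_congr rfl fun k _ => ?_)
  -- Replacing `α_{k+1}` by `-d^{k,λ_0} α_k` turns the `f(t_{k+1})` term into the second term of the
  -- difference operator.
  rw [diffΔ, weight_succ hab hreal h0 hB k]
  ring
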